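/- Let $M$ be a smooth $3$-manifold (Hausdorff, second countable, without boundary; all objects on $M$ are smooth), let $\alpha\in\Omega^1(M)$ be a contact form, i.e. $\alpha\wedge d\alpha$ is nowhere zero, and let $M$ carry the orientation given by $\alpha\wedge d\alpha$. For a Riemannian metric $g$ on $M$ let $\ast_g$ be its Hodge star operator and $\sharp$ its isomorphism $T^*M\to TM$; $g$ is called adapted to $\alpha$ if $d\alpha=2\ast_g\alpha$ and $g(\alpha^\sharp,\alpha^\sharp)=1$. Let $\omega\in\mathbb R\setminus\{0\}$. Then there are a Riemannian metric $g_0$ on $M$ adapted to $\alpha$ and a $1$-form $\beta\in\Omega^1(M)$ such that, in the electromagnetic medium $g_\varepsilon=g_\mu=g:=\tfrac{4}{\omega^2}\,g_0$, the fields $$E(x,t)=\operatorname{Re}\{\alpha e^{i\omega t}\},\qquad H(x,t)=\operatorname{Im}\{\beta e^{i\omega t}\},\qquad (x,t)\in M\times\mathbb R,$$ together with $D=\ast_g E$ and $B=\ast_g H$ (the constitutive equations $D=\ast_\varepsilon E$, $B=\ast_\mu H$ of this medium), solve the source-free Maxwell equations $$dE=-\frac{\partial B}{\partial t},\qquad dH=\frac{\partial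 D}{\partial t},\qquad dD=0,\qquad dB=0 .$$ -/

import Mathlib

open scoped Manifold ContDiff Bundle

noncomputable section

namespace ContactMaxwell

/-- The model space `ℝ³`. -/
abbrev E3 : Type := EuclideanSpace ℝ (Fin 3)

section Algebra

/-- The covector underlying an alternating `1`-form. -/
def toCovector {V : Type*} [AddCommGroup V] [Module ℝ V] [TopologicalSpace V]
    (a : V [⋀^Fin 1]→L[ℝ] ℝ) : V →L[ℝ] ℝ :=
  (ContinuousAlternatingMap.ofSubsingleton ℝ V ℝ (0 : Fin 1)).symm a

theorem toCovector_apply {V : Type*} [AddCommGroup V] [Module ℝ V] [TopologicalSpace V]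
    (a : V [⋀^Fin 1]→L[ℝ] ℝ) (v : V) : toCovector a v = a ![v] := by
  change a _ = a _
  congr 1
  ext i
  fin_cases i
  rfl

/-- The wedge product of an alternating `1`-form and an alternating `k`-form:
`(a ∧ η)(v₀, …, v_k) = ∑ i, (-1) ^ i a(v_i) η(v₀, …, v_{i-1}, v_{i+1}, …, v_k)`. -/
def wedgeAlt {k : ℕ} (a : E3 [⋀^Fin 1]→L[ℝ] ℝ) (η : E3 [⋀^Fin k]→L[ℝ] ℝ) :
    E3 [⋀^Fin (k + 1)]→L[ℝ] ℝ :=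
  ContinuousAlternatingMap.alternatizeUncurryFin ((toCovector a).smulRight η)

/-- The interior product `ι_v η`, that is `(ι_v η)(v₁, …, v_k) = η(v, v₁, …, v_k)`. -/
def interiorAlt {k : ℕ} (v : E3) (η : E3 [⋀^Fin (k + 1)]→L[ℝ] ℝ) : E3 [⋀^Fin k]→L[ℝ] ℝ :=
  η.curryLeft v

end Algebra

variable {M : Type*} [TopologicalSpace M] [ChartedSpace E3 M]

variable (M) in
/-- Fields of alternating `k`-forms on the tangent spaces of a `3`-manifold `M`. Smoothness is the
separate predicate `IsSmoothForm`. -/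
abbrev Form (k : ℕ) : Type _ := ∀ x : M, TangentSpace (𝓡 3) x [⋀^Fin k]→L[ℝ] ℝ

/-- The expression of a `k`-form in the chart around `x₀`: its pullback under the inverse of the
chart (meaningful on the target of the chart). -/
def chartRep {k : ℕ} (η : Form M k) (x₀ : M) (y : E3) : E3 [⋀^Fin k]→L[ℝ] ℝ :=
  (η ((extChartAt (𝓡 3) x₀).symm y)).compContinuousLinearMap
    (mfderiv 𝓘(ℝ, E3) (𝓡 3) (extChartAt (𝓡 3) x₀).symm y)

/-- A `k`-form is smooth if it is smooth in the charts. -/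
def IsSmoothForm {k : ℕ} (η : Form M k) : Prop :=
  ∀ x₀ : M, ContDiffOn ℝ ∞ (chartRep η x₀) (extChartAt (𝓡 3) x₀).target

/-- A `k`-form depending on a parameter `t ∈ ℝ` is smooth if, in the charts, it is smooth jointly
in `t` and in the point. -/
def IsSmoothFamily {k : ℕ} (η : ℝ → Form M k) : Prop :=
  ∀ x₀ : M, ContDiffOn ℝ ∞ (fun p : ℝ × E3 ↦ chartRep (η p.1) x₀ p.2)
    (Set.univ ×ˢ (extChartAt (𝓡 3) x₀).target)

/-- The exterior derivative: at `x`, the pullback by the chart around `x` of the exterior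
derivative of the expression of the form in that chart. -/
def extDer {k : ℕ} (η : Form M k) : Form M (k + 1) := fun x ↦
  (extDeriv (chartRep η x) (extChartAt (𝓡 3) x x)).compContinuousLinearMap
    (mfderiv (𝓡 3) 𝓘(ℝ, E3) (extChartAt (𝓡 3) x) x)

/-- The wedge product of a `1`-form and a `k`-form. -/
def wedge {k : ℕ} (a : Form M 1) (η : Form M k) : Form M (k + 1) := fun x ↦ wedgeAlt (a x) (η x)

/-- A contact form: a smooth `1`-form `α` such that `α ∧ dα` vanishes nowhere. -/
structure IsContactForm (α : Form M 1) : Prop where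
  smooth : IsSmoothForm α
  wedge_ne_zero : ∀ x, wedge α (extDer α) x ≠ 0

/-- The source-free Maxwell equations for time dependent fields. Time derivatives of forms are taken
at each point, on each tuple of tangent vectors. -/
structure IsSourceFreeMaxwell (E H : ℝ → Form M 1) (D B : ℝ → Form M 2) : Prop where
  smooth_E : IsSmoothFamily E
  smooth_H : IsSmoothFamily H
  smooth_D : IsSmoothFamily D
  smooth_B : IsSmoothFamily B
  /-- `dE = - ∂B/∂t` -/
  faraday : ∀ t x v, HasDerivAt (fun s ↦ B s x v) (-(extDer (E t) x v)) t
  /-- `dH = ∂D/∂t` -/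
  ampere : ∀ t x v, HasDerivAt (fun s ↦ D s x v) (extDer (H t) x v) t
  /-- `dD = 0` -/
  gauss_D : ∀ t x, extDer (D t) x = 0
  /-- `dB = 0` -/
  gauss_B : ∀ t x, extDer (B t) x = 0

variable (M) in
/-- Smooth Riemannian metrics on `M`. -/
abbrev RMetric [IsManifold (𝓡 3) ∞ M] : Type _ :=
  Bundle.ContMDiffRiemannianMetric (𝓡 3) ∞ E3 (fun x : M ↦ TangentSpace (𝓡 3) x)

/-- The coordinate basis of the tangent space at `x` given by the chart around `x`. -/
def coordVec (x : M) (i : Fin 3) : TangentSpace (𝓡 3) x := EuclideanSpace.single i (1 : ℝ)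

variable [IsManifold (𝓡 3) ∞ M]

/-- The Gram matrix `g_{ij}` of a metric in the coordinate basis at `x`. -/
def gram (g : RMetric M) (x : M) : Matrix (Fin 3) (Fin 3) ℝ :=
  Matrix.of fun i j ↦ g.inner x (coordVec x i) (coordVec x j)

/-- The Riemannian volume form of `g` for the orientation given by a nowhere vanishing `3`-form
`θ`. In the coordinate basis `∂₁, ∂₂, ∂₃` it is `± √|g| dx¹ ∧ dx² ∧ dx³` where the sign is that
of `θ(∂₁, ∂₂, ∂₃)`, that is, `√|g| dx¹ ∧ dx² ∧ dx³` in positively oriented coordinates. -/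
def volForm (g : RMetric M) (θ : Form M 3) : Form M 3 := fun x ↦
  (Real.sqrt (gram g x).det / |θ x (coordVec x)|) • θ x

/-- The vector `a♯` dual to a `1`-form `a` with respect to `g`: `g(a♯, w) = a(w)`. -/
def sharp (g : RMetric M) (a : Form M 1) (x : M) : TangentSpace (𝓡 3) x :=
  (g.inner x).inverse (toCovector (a x))

/-- The Hodge star operator on `1`-forms, of the metric `g` and the orientation given by the
`3`-form `θ`: `⋆ a = ι_{a♯} dV`. In positively oriented coordinates this says
`⋆ dxⁱ = (√|g| / 2) g^{il} ε_{lmn} dx^m ∧ dx^n`. -/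
def hodge (g : RMetric M) (θ : Form M 3) (a : Form M 1) : Form M 2 := fun x ↦
  interiorAlt (sharp g a x) (volForm g θ x)

/-- A Riemannian metric `g` is adapted to a contact form `α` if `dα = 2 ⋆ α` and
`g(α♯, α♯) = 1`, where `M` carries the orientation given by `α ∧ dα`. -/
structure IsAdapted (g : RMetric M) (α : Form M 1) : Prop where
  extDer_eq : ∀ x, extDer α x = (2 : ℝ) • hodge g (wedge α (extDer α)) α x
  norm_sharp : ∀ x, g.inner x (sharp g α x) (sharp g α x) = 1

/-- The constitutive equations `D = ⋆_ε E` and `B = ⋆_μ H` of the electromagnetic medium given by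
the Riemannian metrics `gε` and `gμ`, where `M` is oriented by the `3`-form `θ`. -/
structure IsConstitutive (gε gμ : RMetric M) (θ : Form M 3)
    (E H : ℝ → Form M 1) (D B : ℝ → Form M 2) : Prop where
  electric : ∀ t x, D t x = hodge gε θ (E t) x
  magnetic : ∀ t x, B t x = hodge gμ θ (H t) x

end ContactMaxwell

end

/-! Let `r` be the Reeb vector: `α(r) = 1` and `ι_r dα = 0`. If a metric satisfies `g₀(r, ·) = α`,
then `α♯ = r` is a unit vector and `⋆α = ι_r dV`. If moreover `dV = (α ∧ dα)/2`, then `⋆α = dα/2`,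
because `ι_r (α ∧ dα) = dα`. So adaptedness needs only these two conditions; the shape of the metric
on `ker α` does not matter beyond its area.

The first condition, with symmetry and positivity, is convex (`convex_reebMetrics`). Local solutions
are sums of squares of covectors (`stdReebMetric_mem`), and a partition of unity glues them
(`exists_reebField`). Multiplying the metric by `c` on `ker α`, which has rank two, multiplies the
Gram determinant by `c²` (`det_gramMat_scaleKer`) and keeps the first condition, so a unique smooth
positive `c` achieves the second (`exists_adapted_metric`).

In dimension three `c² g₀` has `⋆α = (c/2) dα` (`hodge_of_reebMetric`). With `c = 2/|ω|` this is
`dα/|ω|`. Every field is then a function of time multiplied by `α` or `dα`: the Gauss laws are `d² =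
0`, and the other two equations are derivatives of sine and cosine once `β = -sign(ω) α`. -/

noncomputable section

namespace ContactMaxwell

/-! ### Alternating forms on `ℝ³` in coordinates -/

/-- The standard basis of `E3`. -/
def stdVec (i : Fin 3) : E3 := EuclideanSpace.single i (1 : ℝ)

theorem stdVec_coord (i j : Fin 3) : stdVec i j = if j = i then 1 else 0 := by
  simp [stdVec]

theorem sum_smul_stdVec (v : E3) : v = v 0 • stdVec 0 + v 1 • stdVec 1 + v 2 • stdVec 2 := by
  ext i
  fin_cases i <;> simp [stdVec]

theorem wedgeAlt_apply_two (a : E3 [⋀^Fin 1]→L[ℝ] ℝ) (η : E3 [⋀^Fin 2]→L[ℝ] ℝ) (u v w : E3) :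
    wedgeAlt a η ![u, v, w] =
      a ![u] * η ![v, w] - a ![v] * η ![u, w] + a ![w] * η ![u, v] := by
  have h0 : Fin.removeNth 0 ![u, v, w] = ![v, w] := by
    ext i : 1; fin_cases i <;> rfl
  have h1 : Fin.removeNth 1 ![u, v, w] = ![u, w] := by
    ext i : 1; fin_cases i <;> rfl
  have h2 : Fin.removeNth 2 ![u, v, w] = ![u, v] := by
    ext i : 1; fin_cases i <;> rfl
  rw [wedgeAlt, ContinuousAlternatingMap.alternatizeUncurryFin_apply, Fin.sum_univ_three, h0, h1,
    h2]
  simp [toCovector_apply]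
  ring

theorem wedgeAlt_compContinuousLinearMap {k : ℕ} (a : E3 [⋀^Fin 1]→L[ℝ] ℝ)
    (η : E3 [⋀^Fin k]→L[ℝ] ℝ) (L : E3 →L[ℝ] E3) :
    wedgeAlt (a.compContinuousLinearMap L) (η.compContinuousLinearMap L) =
      (wedgeAlt a η).compContinuousLinearMap L := by
  ext v
  simp only [wedgeAlt, ContinuousAlternatingMap.compContinuousLinearMap_apply,
    ContinuousAlternatingMap.alternatizeUncurryFin_apply]
  refine Finset.sum_congr rfl fun i _ ↦ ?_
  have : toCovector (a.compContinuousLinearMap L) (v i) = toCovector a (L (v i)) := by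
    rw [toCovector_apply, toCovector_apply, ContinuousAlternatingMap.compContinuousLinearMap_apply]
    congr 1; ext j : 1; fin_cases j; rfl
  have h2 : L ∘ i.removeNth v = i.removeNth (L ∘ v) := rfl
  simp [this, h2]

/-- The covector `w ↦ η(v, w)` of an alternating `2`-form `η`. -/
def bilin (η : E3 [⋀^Fin 2]→L[ℝ] ℝ) (v : E3) : E3 →L[ℝ] ℝ :=
  toCovector (interiorAlt v η)

theorem bilin_apply (η : E3 [⋀^Fin 2]→L[ℝ] ℝ) (v w : E3) : bilin η v w = η ![v, w] := by
  rw [bilin, toCovector_apply]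
  rfl

theorem apply_pair_add_left (η : E3 [⋀^Fin 2]→L[ℝ] ℝ) (u v w : E3) :
    η ![u + v, w] = η ![u, w] + η ![v, w] := by
  have := η.vecCons_add ![w] u v
  exact this

theorem apply_pair_smul_left (η : E3 [⋀^Fin 2]→L[ℝ] ℝ) (c : ℝ) (u w : E3) :
    η ![c • u, w] = c * η ![u, w] := by
  have := η.vecCons_smul ![w] c u
  exact this

theorem apply_pair_swap (η : E3 [⋀^Fin 2]→L[ℝ] ℝ) (v w : E3) : η ![w, v] = - η ![v, w] := by
  have h := η.map_swap ![v, w] (show (0 : Fin 2) ≠ 1 by decide)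
  have e : ![v, w] ∘ Equiv.swap (0 : Fin 2) 1 = ![w, v] := by ext j : 1; fin_cases j <;> rfl
  rw [e] at h
  exact h

theorem apply_pair_self (η : E3 [⋀^Fin 2]→L[ℝ] ℝ) (v : E3) : η ![v, v] = 0 := by
  have := apply_pair_swap η v v
  linarith

/-- The expansion of an alternating `2`-form in coordinates. -/
theorem apply_pair_coord (η : E3 [⋀^Fin 2]→L[ℝ] ℝ) (v w : E3) :
    η ![v, w] = (v 0 * w 1 - v 1 * w 0) * η ![stdVec 0, stdVec 1]
      + (v 0 * w 2 - v 2 * w 0) * η ![stdVec 0, stdVec 2]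
      + (v 1 * w 2 - v 2 * w 1) * η ![stdVec 1, stdVec 2] := by
  have key : ∀ x y : E3, η ![x, y] = x 0 * η ![stdVec 0, y] + x 1 * η ![stdVec 1, y]
      + x 2 * η ![stdVec 2, y] := fun x y ↦ by
    conv_lhs => rw [sum_smul_stdVec x]
    simp only [apply_pair_add_left, apply_pair_smul_left]
  rw [key v w, apply_pair_swap η w (stdVec 0), apply_pair_swap η w (stdVec 1),
    apply_pair_swap η w (stdVec 2), key w (stdVec 0), key w (stdVec 1), key w (stdVec 2),
    apply_pair_self, apply_pair_self, apply_pair_self, apply_pair_swap η (stdVec 0) (stdVec 1),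
    apply_pair_swap η (stdVec 0) (stdVec 2), apply_pair_swap η (stdVec 1) (stdVec 2)]
  ring

theorem apply_single_coord (a : E3 [⋀^Fin 1]→L[ℝ] ℝ) (v : E3) :
    a ![v] = v 0 * a ![stdVec 0] + v 1 * a ![stdVec 1] + v 2 * a ![stdVec 2] := by
  simp only [← toCovector_apply]
  conv_lhs => rw [sum_smul_stdVec v]
  simp

theorem apply_triple_stdVec (a : E3 [⋀^Fin 1]→L[ℝ] ℝ) (η : E3 [⋀^Fin 2]→L[ℝ] ℝ) :
    wedgeAlt a η stdVec = a ![stdVec 0] * η ![stdVec 1, stdVec 2]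
      - a ![stdVec 1] * η ![stdVec 0, stdVec 2] + a ![stdVec 2] * η ![stdVec 0, stdVec 1] := by
  rw [← wedgeAlt_apply_two]
  congr 1; ext i : 1; fin_cases i <;> rfl

/-- The standard basis of `E3`, as a basis. -/
def stdBasis : Module.Basis (Fin 3) ℝ E3 := (EuclideanSpace.basisFun (Fin 3) ℝ).toBasis

theorem stdBasis_apply (i : Fin 3) : stdBasis i = stdVec i := by
  simp [stdBasis, stdVec]

theorem coe_stdBasis : (stdBasis : Fin 3 → E3) = stdVec := funext stdBasis_apply

theorem top_form_comp (θ : E3 [⋀^Fin 3]→L[ℝ] ℝ) (L : E3 →L[ℝ] E3) :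
    θ.compContinuousLinearMap L stdVec = LinearMap.det (L : E3 →ₗ[ℝ] E3) * θ stdVec := by
  have h := AlternatingMap.eq_smul_basis_det stdBasis θ.toAlternatingMap
  have h1 : ∀ v : Fin 3 → E3, θ v = θ stdVec * stdBasis.det v := fun v ↦ by
    have := congrArg (fun f ↦ f v) h
    simpa [coe_stdBasis] using this
  rw [ContinuousAlternatingMap.compContinuousLinearMap_apply, h1]
  have h2 := stdBasis.det_comp (L : E3 →ₗ[ℝ] E3) stdVec
  have h3 : stdBasis.det stdVec = 1 := by rw [← coe_stdBasis, stdBasis.det_self]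
  rw [h3, mul_one] at h2
  have h4 : stdBasis.det (L ∘ stdVec) = LinearMap.det (L : E3 →ₗ[ℝ] E3) := h2
  rw [h4, mul_comm]

theorem top_form_ne_zero {θ : E3 [⋀^Fin 3]→L[ℝ] ℝ} (h : θ ≠ 0) : θ stdVec ≠ 0 := by
  contrapose! h
  have h1 := AlternatingMap.eq_smul_basis_det stdBasis θ.toAlternatingMap
  ext v
  have := congrArg (fun f ↦ f v) h1
  simpa [coe_stdBasis, h] using this

/-! ### Reeb vectors -/

/-- A `1`-form and a `2`-form with nonzero wedge product have a Reeb vector. -/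
theorem exists_reeb {a : E3 [⋀^Fin 1]→L[ℝ] ℝ} {η : E3 [⋀^Fin 2]→L[ℝ] ℝ} (h : wedgeAlt a η ≠ 0) :
    ∃ r : E3, a ![r] = 1 ∧ ∀ v, η ![r, v] = 0 := by
  have h' := top_form_ne_zero h
  -- The vector in parentheses spans the kernel of `η` (it is `η` read as a vector through the
  -- volume form), and `a` takes the value `(a ∧ η)(e₀, e₁, e₂)` on it.
  refine ⟨(wedgeAlt a η stdVec)⁻¹ • (η ![stdVec 1, stdVec 2] • stdVec 0
    - η ![stdVec 0, stdVec 2] • stdVec 1 + η ![stdVec 0, stdVec 1] • stdVec 2), ?_, fun v ↦ ?_⟩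
  · rw [apply_single_coord]
    simp [stdVec_coord]
    field_simp
    rw [apply_triple_stdVec]
    ring
  · rw [apply_pair_smul_left, apply_pair_coord]
    simp [stdVec_coord]
    right
    ring

/-- The kernel of `η` is a line on which `a` is injective. In coordinates this is Cramer's rule: `(a
∧ η)(e₀, e₁, e₂)` times each coordinate of `v` is a combination of the vanishing quantities. -/
theorem eq_zero_of_apply_eq_zero {a : E3 [⋀^Fin 1]→L[ℝ] ℝ} {η : E3 [⋀^Fin 2]→L[ℝ] ℝ}
    (h : wedgeAlt a η ≠ 0) {v : E3} (ha : a ![v] = 0) (hη : ∀ i, η ![stdVec i, v] = 0) :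
    v = 0 := by
  have h' := top_form_ne_zero h
  have h0 := hη 0
  have h1 := hη 1
  have h2 := hη 2
  rw [apply_single_coord] at ha
  rw [apply_pair_coord] at h0 h1 h2
  simp [stdVec_coord] at h0 h1 h2
  have e := apply_triple_stdVec a η
  have e0 : wedgeAlt a η stdVec * v 0 = 0 := by
    rw [e]
    linear_combination η ![stdVec 1, stdVec 2] * ha + a ![stdVec 1] * h2 - a ![stdVec 2] * h1
  have e1 : wedgeAlt a η stdVec * v 1 = 0 := by
    rw [e]
    linear_combination -η ![stdVec 0, stdVec 2] * ha - a ![stdVec 0] * h2 + a ![stdVec 2] * h0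
  have e2 : wedgeAlt a η stdVec * v 2 = 0 := by
    rw [e]
    linear_combination η ![stdVec 0, stdVec 1] * ha + a ![stdVec 0] * h1 - a ![stdVec 1] * h0
  rw [sum_smul_stdVec v, (mul_eq_zero.1 e0).resolve_left h', (mul_eq_zero.1 e1).resolve_left h',
    (mul_eq_zero.1 e2).resolve_left h']
  simp

/-! ### Gram determinants and volume ratios -/

/-- The Gram matrix of a bilinear form in the standard basis. -/
def gramMat (b : E3 →L[ℝ] E3 →L[ℝ] ℝ) : Matrix (Fin 3) (Fin 3) ℝ :=
  Matrix.of fun i j ↦ b (stdVec i) (stdVec j)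

theorem det_gramMat_comp (b : E3 →L[ℝ] E3 →L[ℝ] ℝ) (L : E3 →L[ℝ] E3) :
    (gramMat (b.bilinearComp L L)).det =
      LinearMap.det (L : E3 →ₗ[ℝ] E3) ^ 2 * (gramMat b).det := by
  have key : gramMat (b.bilinearComp L L) =
      (LinearMap.toMatrix stdBasis stdBasis (L : E3 →ₗ[ℝ] E3)).transpose * gramMat b *
        LinearMap.toMatrix stdBasis stdBasis (L : E3 →ₗ[ℝ] E3) := by
    have hL : ∀ i, L (stdVec i) = ∑ k, LinearMap.toMatrix stdBasis stdBasis (L : E3 →ₗ[ℝ] E3) k i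
        • stdVec k := fun i ↦ by
      have := stdBasis.sum_repr (L (stdVec i))
      rw [← this]
      refine Finset.sum_congr rfl fun k _ ↦ ?_
      rw [LinearMap.toMatrix_apply, stdBasis_apply, stdBasis_apply, ContinuousLinearMap.coe_coe]
    ext i j
    simp only [gramMat, Matrix.of_apply, ContinuousLinearMap.bilinearComp_apply, hL, map_sum,
      map_smul, sum_apply, smul_apply, Matrix.mul_apply,
      Matrix.transpose_apply, smul_eq_mul, Finset.mul_sum, Finset.sum_mul]
    refine Finset.sum_congr rfl fun k _ ↦ Finset.sum_congr rfl fun l _ ↦ ?_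
    ring
  rw [key, Matrix.det_mul, Matrix.det_mul, Matrix.det_transpose, LinearMap.det_toMatrix]
  ring

/-- Half the ratio of a volume form and the volume form of a metric. -/
def volRatio (θ : E3 [⋀^Fin 3]→L[ℝ] ℝ) (b : E3 →L[ℝ] E3 →L[ℝ] ℝ) : ℝ :=
  |θ stdVec| / (2 * Real.sqrt (gramMat b).det)

/-- Numerator and denominator both acquire the factor `|det L|`, so the ratio is a genuine function
on the manifold, computable in any chart. -/
theorem volRatio_comp (θ : E3 [⋀^Fin 3]→L[ℝ] ℝ) (b : E3 →L[ℝ] E3 →L[ℝ] ℝ) {L : E3 →L[ℝ] E3}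
    (hL : LinearMap.det (L : E3 →ₗ[ℝ] E3) ≠ 0) :
    volRatio (θ.compContinuousLinearMap L) (b.bilinearComp L L) = volRatio θ b := by
  rw [volRatio, volRatio, top_form_comp, det_gramMat_comp, Real.sqrt_mul (sq_nonneg _),
    Real.sqrt_sq_eq_abs, abs_mul, mul_left_comm, mul_div_mul_left _ _ (abs_ne_zero.2 hL)]

/-! ### Inner products adapted to the Reeb direction -/

/-- The inner products for which a Reeb vector of the `1`-form `a` and the `2`-form `η` is a unit
vector orthogonal to the kernel of `a`. -/
def reebMetrics (a : E3 [⋀^Fin 1]→L[ℝ] ℝ) (η : E3 [⋀^Fin 2]→L[ℝ] ℝ) :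
    Set (E3 →L[ℝ] E3 →L[ℝ] ℝ) :=
  {b | (∀ v w, b v w = b w v) ∧ (∀ v, v ≠ 0 → 0 < b v v) ∧
    ∀ r, (∀ v, η ![r, v] = 0) → ∀ w, b r w = a ![r] * a ![w]}

/-- The Reeb condition prescribes `b r w` by a value independent of `b`, hence is affine in `b`.
This is what permits gluing by a partition of unity. -/
theorem convex_reebMetrics (a : E3 [⋀^Fin 1]→L[ℝ] ℝ) (η : E3 [⋀^Fin 2]→L[ℝ] ℝ) :
    Convex ℝ (reebMetrics a η) := by
  rintro b ⟨hb1, hb2, hb3⟩ c ⟨hc1, hc2, hc3⟩ s t hs ht hst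
  refine ⟨fun v w ↦ ?_, fun v hv ↦ ?_, fun r hr w ↦ ?_⟩
  · simp [hb1 v w, hc1 v w]
  · simp only [add_apply, smul_apply, smul_eq_mul]
    rcases hs.eq_or_lt with rfl | hs
    · have : t = 1 := by linarith
      simpa [this] using hc2 v hv
    · have := mul_pos hs (hb2 v hv)
      have := mul_nonneg ht (hc2 v hv).le
      linarith
  · simp only [add_apply, smul_apply, smul_eq_mul,
      hb3 r hr, hc3 r hr]
    rw [← add_mul, hst, one_mul]

theorem comp_single (a : E3 [⋀^Fin 1]→L[ℝ] ℝ) (L : E3 →L[ℝ] E3) (v : E3) :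
    a.compContinuousLinearMap L ![v] = a ![L v] := by
  rw [ContinuousAlternatingMap.compContinuousLinearMap_apply]
  congr 1; ext j : 1; fin_cases j; rfl

theorem comp_pair (η : E3 [⋀^Fin 2]→L[ℝ] ℝ) (L : E3 →L[ℝ] E3) (v w : E3) :
    η.compContinuousLinearMap L ![v, w] = η ![L v, L w] := by
  rw [ContinuousAlternatingMap.compContinuousLinearMap_apply]
  congr 1; ext j : 1; fin_cases j <;> rfl

theorem comp_mem_reebMetrics {a : E3 [⋀^Fin 1]→L[ℝ] ℝ} {η : E3 [⋀^Fin 2]→L[ℝ] ℝ}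
    {b : E3 →L[ℝ] E3 →L[ℝ] ℝ} (hb : b ∈ reebMetrics a η) {L K : E3 →L[ℝ] E3}
    (hLK : ∀ v, L (K v) = v) (hKL : ∀ v, K (L v) = v) :
    b.bilinearComp L L ∈
      reebMetrics (a.compContinuousLinearMap L) (η.compContinuousLinearMap L) := by
  refine ⟨fun v w ↦ hb.1 _ _, fun v hv ↦ hb.2.1 _ fun h ↦ hv ?_, fun r hr w ↦ ?_⟩
  · rw [← hKL v, show L v = 0 from h, map_zero]
  · rw [ContinuousLinearMap.bilinearComp_apply, comp_single, comp_single]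
    refine hb.2.2 _ (fun v ↦ ?_) _
    have := hr (K v)
    rwa [comp_pair, hLK] at this

/-- The tensor square of a `1`-form. -/
def tensorSq (a : E3 [⋀^Fin 1]→L[ℝ] ℝ) : E3 →L[ℝ] E3 →L[ℝ] ℝ :=
  (toCovector a).smulRight (toCovector a)

theorem tensorSq_apply (a : E3 [⋀^Fin 1]→L[ℝ] ℝ) (v w : E3) :
    tensorSq a v w = a ![v] * a ![w] := by
  simp [tensorSq, toCovector_apply]

/-- A standard element of `reebMetrics a η`. -/
def stdReebMetric (a : E3 [⋀^Fin 1]→L[ℝ] ℝ) (η : E3 [⋀^Fin 2]→L[ℝ] ℝ) :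
    E3 →L[ℝ] E3 →L[ℝ] ℝ :=
  tensorSq a + ∑ i : Fin 3, (bilin η (stdVec i)).smulRight (bilin η (stdVec i))

theorem stdReebMetric_apply (a : E3 [⋀^Fin 1]→L[ℝ] ℝ) (η : E3 [⋀^Fin 2]→L[ℝ] ℝ) (v w : E3) :
    stdReebMetric a η v w =
      a ![v] * a ![w] + ∑ i : Fin 3, η ![stdVec i, v] * η ![stdVec i, w] := by
  simp [stdReebMetric, tensorSq_apply, bilin_apply]

/-- A sum of squares of the covectors `a` and `η(eᵢ, ·)`: these have no common zero except `0`, and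
all but `a` vanish on the kernel of `η`. -/
theorem stdReebMetric_mem {a : E3 [⋀^Fin 1]→L[ℝ] ℝ} {η : E3 [⋀^Fin 2]→L[ℝ] ℝ}
    (h : wedgeAlt a η ≠ 0) : stdReebMetric a η ∈ reebMetrics a η := by
  refine ⟨fun v w ↦ ?_, fun v hv ↦ ?_, fun r hr w ↦ ?_⟩
  · simp only [stdReebMetric_apply, mul_comm]
  · have hs : 0 ≤ ∑ i : Fin 3, η ![stdVec i, v] * η ![stdVec i, v] :=
      Finset.sum_nonneg fun i _ ↦ mul_self_nonneg _
    have h0 : 0 ≤ stdReebMetric a η v v := by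
      rw [stdReebMetric_apply]
      exact add_nonneg (mul_self_nonneg _) hs
    refine lt_of_le_of_ne h0 fun h1 ↦ hv ?_
    rw [stdReebMetric_apply] at h1
    have ha : a ![v] * a ![v] = 0 := by linarith [mul_self_nonneg (a ![v])]
    have hη : ∑ i : Fin 3, η ![stdVec i, v] * η ![stdVec i, v] = 0 := by
      linarith [mul_self_nonneg (a ![v])]
    rw [Finset.sum_eq_zero_iff_of_nonneg fun i _ ↦ mul_self_nonneg _] at hη
    exact eq_zero_of_apply_eq_zero h (mul_self_eq_zero.1 ha)
      fun i ↦ mul_self_eq_zero.1 (hη i (Finset.mem_univ i))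
  · rw [stdReebMetric_apply]
    simp [apply_pair_swap η r, hr]

/-! ### Scaling on the kernel of the contact form -/

/-- Scaling of a metric in `reebMetrics a η` on the kernel of `a`. -/
def scaleKer (a : E3 [⋀^Fin 1]→L[ℝ] ℝ) (c : ℝ) (b : E3 →L[ℝ] E3 →L[ℝ] ℝ) :
    E3 →L[ℝ] E3 →L[ℝ] ℝ :=
  tensorSq a + c • (b - tensorSq a)

theorem scaleKer_apply (a : E3 [⋀^Fin 1]→L[ℝ] ℝ) (c : ℝ) (b : E3 →L[ℝ] E3 →L[ℝ] ℝ) (v w : E3) :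
    scaleKer a c b v w = a ![v] * a ![w] + c * (b v w - a ![v] * a ![w]) := by
  simp [scaleKer, tensorSq_apply]

section

variable {a : E3 [⋀^Fin 1]→L[ℝ] ℝ} {η : E3 [⋀^Fin 2]→L[ℝ] ℝ} {b : E3 →L[ℝ] E3 →L[ℝ] ℝ}

/-- `b - a ⊗ a` at `v` is the `b`-square of the projection `v - a(v) r` to `ker a`. If the
projection is nonzero, the scaled term is positive; otherwise `v = a(v) r` and the term `a(v)²` is.
-/
theorem scaleKer_mem (hb : b ∈ reebMetrics a η) (h : wedgeAlt a η ≠ 0) {c : ℝ} (hc : 0 < c) :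
    scaleKer a c b ∈ reebMetrics a η := by
  refine ⟨fun v w ↦ ?_, fun v hv ↦ ?_, fun r hr w ↦ ?_⟩
  · simp only [scaleKer_apply, hb.1 v w, mul_comm]
  · obtain ⟨r, hr1, hr2⟩ := exists_reeb h
    rw [scaleKer_apply]
    have hbr := hb.2.2 r hr2
    simp only [hr1, one_mul] at hbr
    have hu : b (v - a ![v] • r) (v - a ![v] • r) = b v v - a ![v] * a ![v] := by
      simp only [map_sub, map_smul, sub_apply, smul_apply,
        smul_eq_mul, hbr, hr1, hb.1 v r]
      ring
    by_cases h0 : v - a ![v] • r = 0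
    · have ha : a ![v] ≠ 0 := fun ha ↦ hv (by simpa [ha] using h0)
      have : b v v - a ![v] * a ![v] = 0 := by rw [← hu, h0]; simp
      rw [this, mul_zero, add_zero]
      exact mul_self_pos.2 ha
    · have := mul_pos hc (hu ▸ hb.2.1 _ h0)
      have := mul_self_nonneg (a ![v])
      linarith
  · rw [scaleKer_apply, hb.2.2 r hr]
    ring

theorem det_add_vecMulVec (N : Matrix (Fin 3) (Fin 3) ℝ) (p q : Fin 3 → ℝ) (c : ℝ) :
    (Matrix.vecMulVec p q + c • N).det =
      c ^ 3 * N.det + c ^ 2 * ((Matrix.vecMulVec p q + N).det - N.det) := by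
  simp [Matrix.det_fin_three, Matrix.vecMulVec_apply]
  ring

/-- The Gram matrix is `p pᵀ + c N`, with `N` the matrix of `b - a ⊗ a`. The Reeb vector annihilates
`N`, so the `c³` term of the rank-one expansion drops out. -/
theorem det_gramMat_scaleKer (hb : b ∈ reebMetrics a η) (h : wedgeAlt a η ≠ 0) (c : ℝ) :
    (gramMat (scaleKer a c b)).det = c ^ 2 * (gramMat b).det := by
  obtain ⟨r, hr1, hr2⟩ := exists_reeb h
  set p : Fin 3 → ℝ := fun i ↦ a ![stdVec i] with hp
  set N := gramMat b - Matrix.vecMulVec p p with hN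
  have h1 : gramMat (scaleKer a c b) = Matrix.vecMulVec p p + c • N := by
    ext i j
    simp [gramMat, scaleKer_apply, hN, Matrix.vecMulVec_apply, hp]
  have h2 : gramMat b = Matrix.vecMulVec p p + N := by rw [hN]; abel
  have h3 : N.det = 0 := by
    refine Matrix.exists_vecMul_eq_zero_iff.1 ⟨fun i ↦ r i, fun h0 ↦ ?_, ?_⟩
    · have : r = 0 := by ext i; exact congrFun h0 i
      rw [this, apply_single_coord] at hr1
      simp at hr1
    · ext j
      have := hb.2.2 r hr2 (stdVec j)
      conv at this => lhs; rw [sum_smul_stdVec r]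
      rw [apply_single_coord a r] at this
      simp only [map_add, map_smul, add_apply, smul_apply,
        smul_eq_mul] at this
      simp only [hN, Matrix.vecMul, dotProduct, Matrix.sub_apply, Fin.sum_univ_three, gramMat,
        Matrix.of_apply, Matrix.vecMulVec_apply, hp, Pi.zero_apply]
      linear_combination this
  rw [h1, det_add_vecMulVec, ← h2, h3]
  ring

theorem gramMat_posDef (hb : b ∈ reebMetrics a η) : (gramMat b).PosDef := by
  refine Matrix.PosDef.of_dotProduct_mulVec_pos ?_ fun x hx ↦ ?_
  · ext i j
    simp [gramMat, hb.1 (stdVec j)]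
  · set v : E3 := WithLp.toLp 2 x with hv
    have hv0 : v ≠ 0 := fun h0 ↦ hx (by simpa [hv] using h0)
    have := hb.2.1 v hv0
    rw [sum_smul_stdVec v] at this
    simp only [map_add, map_smul, add_apply, smul_apply,
        smul_eq_mul] at this
    simp only [gramMat, Matrix.mulVec, dotProduct, Fin.sum_univ_three, Matrix.of_apply,
      Pi.star_apply, star_trivial]
    have hx' : ∀ i, v i = x i := fun i ↦ rfl
    simp only [hx'] at this
    linarith

theorem det_gramMat_pos (hb : b ∈ reebMetrics a η) : 0 < (gramMat b).det :=
  (gramMat_posDef hb).det_pos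

theorem volRatio_pos (hb : b ∈ reebMetrics a η) (h : wedgeAlt a η ≠ 0) :
    0 < volRatio (wedgeAlt a η) b :=
  div_pos (abs_pos.2 (top_form_ne_zero h))
    (mul_pos two_pos (Real.sqrt_pos.2 (det_gramMat_pos hb)))

theorem sqrt_det_scaleKer_volRatio (hb : b ∈ reebMetrics a η) (h : wedgeAlt a η ≠ 0) :
    Real.sqrt (gramMat (scaleKer a (volRatio (wedgeAlt a η) b) b)).det =
      |wedgeAlt a η stdVec| / 2 := by
  have h0 := (Real.sqrt_pos.2 (det_gramMat_pos hb)).ne'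
  rw [det_gramMat_scaleKer hb h, Real.sqrt_mul (sq_nonneg _),
    Real.sqrt_sq (volRatio_pos hb h).le, volRatio]
  field_simp

end

/-- The antiderivation rule `ι_r (a ∧ η) = a(r) η - a ∧ ι_r η`; this turns the Hodge star of `α`
into a multiple of `dα`. -/
theorem interiorAlt_wedgeAlt (a : E3 [⋀^Fin 1]→L[ℝ] ℝ) (η : E3 [⋀^Fin 2]→L[ℝ] ℝ) {r : E3}
    (hr1 : a ![r] = 1) (hr2 : ∀ v, η ![r, v] = 0) : interiorAlt r (wedgeAlt a η) = η := by
  ext v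
  have : v = ![v 0, v 1] := by ext i : 1; fin_cases i <;> rfl
  rw [this]
  change wedgeAlt a η ![r, v 0, v 1] = _
  rw [wedgeAlt_apply_two, hr1, hr2, hr2]
  ring

/-! ### Forms in charts and the exterior derivative -/

section

variable {M : Type*} [TopologicalSpace M] [ChartedSpace E3 M]

theorem two_le_infty : minSmoothness ℝ 2 ≤ (∞ : WithTop ℕ∞) := by
  rw [minSmoothness_of_isRCLikeNormedField]
  exact WithTop.coe_le_coe.2 (le_top : (2 : ℕ∞) ≤ ⊤)

/-- A form at a point, with the tangent space identified with the model space. -/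
def formAt {k : ℕ} (η : Form M k) (p : M) : E3 [⋀^Fin k]→L[ℝ] ℝ := η p

/-- The derivative of the inverse of the chart around `x₀`. -/
def chartSymmDeriv (x₀ : M) (y : E3) : E3 →L[ℝ] E3 :=
  mfderiv 𝓘(ℝ, E3) (𝓡 3) (extChartAt (𝓡 3) x₀).symm y

/-- The derivative of the chart around `x₀`. -/
def chartDeriv (x₀ : M) (p : M) : E3 →L[ℝ] E3 :=
  mfderiv (𝓡 3) 𝓘(ℝ, E3) (extChartAt (𝓡 3) x₀) p

theorem chartRep_eq {k : ℕ} (η : Form M k) (x₀ : M) (y : E3) :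
    chartRep η x₀ y = (formAt η ((extChartAt (𝓡 3) x₀).symm y)).compContinuousLinearMap
      (chartSymmDeriv x₀ y) := rfl

theorem formAt_extDer {k : ℕ} (η : Form M k) (x : M) :
    formAt (extDer η) x = (extDeriv (chartRep η x)
      (extChartAt (𝓡 3) x x)).compContinuousLinearMap (chartDeriv x x) := rfl

theorem formAt_wedge {k : ℕ} (a : Form M 1) (η : Form M k) (x : M) :
    formAt (wedge a η) x = wedgeAlt (formAt a x) (formAt η x) := rfl

theorem IsSmoothForm.contDiffAt {k : ℕ} {η : Form M k} (hη : IsSmoothForm η) {x₀ : M} {y : E3}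
    (hy : y ∈ (extChartAt (𝓡 3) x₀).target) : ContDiffAt ℝ ∞ (chartRep η x₀) y :=
  (hη x₀).contDiffAt ((isOpen_extChartAt_target x₀).mem_nhds hy)

theorem isSmoothForm_smul {k : ℕ} (c : ℝ) {η : Form M k} (hη : IsSmoothForm η) :
    IsSmoothForm (fun x ↦ c • η x) := fun x₀ ↦ (hη x₀).const_smul c

theorem extDer_smul {k : ℕ} (c : ℝ) (η : Form M k) (x : M) :
    extDer (fun x ↦ c • η x) x = c • extDer η x := by
  change formAt (extDer (fun x ↦ c • η x)) x = c • formAt (extDer η) x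
  have h : chartRep (fun x ↦ c • η x) x = c • chartRep η x := rfl
  rw [formAt_extDer, formAt_extDer, h, extDeriv_smul]
  rfl

theorem isSmoothFamily_smul {k : ℕ} {c : ℝ → ℝ} (hc : ContDiff ℝ ∞ c) {η : Form M k}
    (hη : IsSmoothForm η) : IsSmoothFamily (fun t x ↦ c t • η x) := fun x₀ ↦ by
  have h1 : ContDiffOn ℝ ∞ (fun p : ℝ × E3 ↦ chartRep η x₀ p.2)
      (Set.univ ×ˢ (extChartAt (𝓡 3) x₀).target) :=
    (hη x₀).comp contDiff_snd.contDiffOn fun p hp ↦ hp.2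
  exact (hc.comp contDiff_fst).contDiffOn.smul h1

variable [IsManifold (𝓡 3) ∞ M]

theorem mdifferentiableAt_chart_symm {x₀ : M} {y : E3} (hy : y ∈ (extChartAt (𝓡 3) x₀).target) :
    MDifferentiableAt 𝓘(ℝ, E3) (𝓡 3) (extChartAt (𝓡 3) x₀).symm y := by
  have : IsManifold (𝓡 3) 1 M := IsManifold.of_le (n := ∞) (by simp)
  have h := mdifferentiableWithinAt_extChartAt_symm (I := 𝓡 3) hy
  rwa [ModelWithCorners.range_eq_univ, mdifferentiableWithinAt_univ] at h

theorem mdifferentiableAt_chart {x₀ p : M} (hp : p ∈ (extChartAt (𝓡 3) x₀).source) :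
    MDifferentiableAt (𝓡 3) 𝓘(ℝ, E3) (extChartAt (𝓡 3) x₀) p := by
  have : IsManifold (𝓡 3) 1 M := IsManifold.of_le (n := ∞) (by simp)
  exact mdifferentiableAt_extChartAt (by rwa [extChartAt_source] at hp)

/-- The transition between the charts around `x₀` and `x₁`. -/
def transition (x₀ x₁ : M) (y : E3) : E3 :=
  extChartAt (𝓡 3) x₁ ((extChartAt (𝓡 3) x₀).symm y)

theorem fderiv_transition {x₀ x₁ : M} {y : E3} (hy : y ∈ (extChartAt (𝓡 3) x₀).target)
    (hy' : (extChartAt (𝓡 3) x₀).symm y ∈ (extChartAt (𝓡 3) x₁).source) :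
    fderiv ℝ (transition x₀ x₁) y =
      (chartDeriv x₁ ((extChartAt (𝓡 3) x₀).symm y)).comp (chartSymmDeriv x₀ y) := by
  have h := mfderiv_comp y (mdifferentiableAt_chart hy') (mdifferentiableAt_chart_symm hy)
  rw [mfderiv_eq_fderiv] at h
  exact h

theorem chartDeriv_comp_chartSymmDeriv {x₀ : M} {y : E3}
    (hy : y ∈ (extChartAt (𝓡 3) x₀).target) :
    (chartDeriv x₀ ((extChartAt (𝓡 3) x₀).symm y)).comp (chartSymmDeriv x₀ y) =
      ContinuousLinearMap.id ℝ E3 := by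
  have : IsManifold (𝓡 3) 1 M := IsManifold.of_le (n := ∞) (by simp)
  have h := mfderiv_extChartAt_comp_mfderivWithin_extChartAt_symm (I := 𝓡 3) hy
  rw [ModelWithCorners.range_eq_univ, mfderivWithin_univ] at h
  exact h

theorem chartSymmDeriv_comp_chartDeriv {x₀ : M} {y : E3}
    (hy : y ∈ (extChartAt (𝓡 3) x₀).target) :
    (chartSymmDeriv x₀ y).comp (chartDeriv x₀ ((extChartAt (𝓡 3) x₀).symm y)) =
      ContinuousLinearMap.id ℝ E3 := by
  have : IsManifold (𝓡 3) 1 M := IsManifold.of_le (n := ∞) (by simp)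
  have h := mfderivWithin_extChartAt_symm_comp_mfderiv_extChartAt (I := 𝓡 3) hy
  rw [ModelWithCorners.range_eq_univ, mfderivWithin_univ] at h
  exact h

theorem det_chartSymmDeriv_ne_zero {x₀ : M} {y : E3}
    (hy : y ∈ (extChartAt (𝓡 3) x₀).target) :
    LinearMap.det (chartSymmDeriv x₀ y : E3 →ₗ[ℝ] E3) ≠ 0 := by
  intro h0
  have h : (chartDeriv x₀ ((extChartAt (𝓡 3) x₀).symm y) : E3 →ₗ[ℝ] E3) ∘ₗ
      (chartSymmDeriv x₀ y : E3 →ₗ[ℝ] E3) = LinearMap.id :=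
    congrArg ContinuousLinearMap.toLinearMap (chartDeriv_comp_chartSymmDeriv hy)
  have h1 := congrArg LinearMap.det h
  rw [LinearMap.det_comp, h0, mul_zero, LinearMap.det_id] at h1
  exact zero_ne_one h1

theorem chartRep_extChartAt_comp {k : ℕ} (η : Form M k) {x₀ p : M}
    (hp : p ∈ (extChartAt (𝓡 3) x₀).source) :
    (chartRep η x₀ (extChartAt (𝓡 3) x₀ p)).compContinuousLinearMap (chartDeriv x₀ p) =
      formAt η p := by
  have h := chartSymmDeriv_comp_chartDeriv ((extChartAt (𝓡 3) x₀).map_source hp)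
  rw [chartRep_eq]
  rw [(extChartAt (𝓡 3) x₀).left_inv hp] at h ⊢
  ext v
  simp only [ContinuousAlternatingMap.compContinuousLinearMap_apply]
  congr 1
  ext i : 1
  exact congrArg (fun L : E3 →L[ℝ] E3 ↦ L (v i)) h

/-- The change of charts for the expressions of a form. -/
theorem chartRep_transition {k : ℕ} (η : Form M k) {x₀ x₁ : M} {y : E3}
    (hy : y ∈ (extChartAt (𝓡 3) x₀).target)
    (hy' : (extChartAt (𝓡 3) x₀).symm y ∈ (extChartAt (𝓡 3) x₁).source) :
    chartRep η x₀ y = (chartRep η x₁ (transition x₀ x₁ y)).compContinuousLinearMap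
      (fderiv ℝ (transition x₀ x₁) y) := by
  rw [fderiv_transition hy hy', chartRep_eq, ← chartRep_extChartAt_comp η hy']
  rfl

theorem contDiffAt_transition {x₀ x₁ : M} {y : E3} (hy : y ∈ (extChartAt (𝓡 3) x₀).target)
    (hy' : (extChartAt (𝓡 3) x₀).symm y ∈ (extChartAt (𝓡 3) x₁).source) :
    ContDiffAt ℝ ∞ (transition x₀ x₁) y := by
  have h1 : ContMDiffAt 𝓘(ℝ, E3) (𝓡 3) ∞ (extChartAt (𝓡 3) x₀).symm y :=
    (contMDiffOn_extChartAt_symm x₀).contMDiffAt ((isOpen_extChartAt_target x₀).mem_nhds hy)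
  have h2 : ContMDiffAt (𝓡 3) 𝓘(ℝ, E3) ∞ (extChartAt (𝓡 3) x₁)
      ((extChartAt (𝓡 3) x₀).symm y) :=
    contMDiffAt_extChartAt' (by rwa [extChartAt_source] at hy')
  exact contMDiffAt_iff_contDiffAt.1 (h2.comp y h1)

/-- The exterior derivative can be computed in any chart. -/
theorem chartRep_extDer {k : ℕ} {η : Form M k} (hη : IsSmoothForm η) {x₀ : M} {y : E3}
    (hy : y ∈ (extChartAt (𝓡 3) x₀).target) :
    chartRep (extDer η) x₀ y = extDeriv (chartRep η x₀) y := by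
  set p := (extChartAt (𝓡 3) x₀).symm y with hp
  have hy' : p ∈ (extChartAt (𝓡 3) p).source := mem_extChartAt_source p
  -- `extDer` at `p` uses the chart around `p`, so the expression near `y` is rewritten as a
  -- pullback by the transition to that chart; `extDeriv` commutes with the pullback.
  have hev : chartRep η x₀ =ᶠ[nhds y] fun z ↦
      (chartRep η p (transition x₀ p z)).compContinuousLinearMap
        (fderiv ℝ (transition x₀ p) z) := by
    have h1 := (isOpen_extChartAt_target (I := 𝓡 3) x₀).mem_nhds hy
    have h2 : (extChartAt (𝓡 3) x₀).symm ⁻¹' (extChartAt (𝓡 3) p).source ∈ nhds y :=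
      (mdifferentiableAt_chart_symm hy).continuousAt (extChartAt_source_mem_nhds p)
    filter_upwards [h1, h2] with z hz hz' using chartRep_transition η hz hz'
  have hd : DifferentiableAt ℝ (chartRep η p) (transition x₀ p y) :=
    (hη.contDiffAt ((extChartAt (𝓡 3) p).map_source hy')).differentiableAt (by simp)
  rw [hev.extDeriv_eq, extDeriv_pullback hd (contDiffAt_transition hy hy') two_le_infty,
    fderiv_transition hy hy', chartRep_eq, ← hp, formAt_extDer]
  rfl

theorem isSmoothForm_extDer {k : ℕ} {η : Form M k} (hη : IsSmoothForm η) :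
    IsSmoothForm (extDer η) := fun x₀ ↦ by
  have h : ContDiffOn ℝ ∞ (extDeriv (chartRep η x₀)) (extChartAt (𝓡 3) x₀).target := by
    have h1 := (hη x₀).fderiv_of_isOpen (m := ∞) (isOpen_extChartAt_target x₀) (by simp)
    exact (ContinuousAlternatingMap.alternatizeUncurryFinCLM ℝ E3 ℝ).contDiff.comp_contDiffOn h1
  exact h.congr fun y hy ↦ chartRep_extDer hη hy

theorem extDer_extDer {k : ℕ} {η : Form M k} (hη : IsSmoothForm η) (x : M) :
    extDer (extDer η) x = 0 := by
  have hx := mem_extChartAt_target (I := 𝓡 3) x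
  have h : chartRep (extDer η) x =ᶠ[nhds (extChartAt (𝓡 3) x x)] extDeriv (chartRep η x) := by
    filter_upwards [(isOpen_extChartAt_target (I := 𝓡 3) x).mem_nhds hx] with y hy
      using chartRep_extDer hη hy
  change formAt (extDer (extDer η)) x = 0
  rw [formAt_extDer, h.extDeriv_eq,
    extDeriv_extDeriv_apply (hη.contDiffAt hx) two_le_infty]
  rfl

end

/-! ### Smooth bilinear fields and the partition of unity -/

section

variable {M : Type*} [TopologicalSpace M] [ChartedSpace E3 M]

variable (M) in
/-- Fields of bilinear forms on the tangent spaces. -/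
abbrev BilinField : Type _ :=
  ∀ x : M, TangentSpace (𝓡 3) x →L[ℝ] TangentSpace (𝓡 3) x →L[ℝ] ℝ

/-- A bilinear field at a point, with the tangent space identified with the model space. -/
def bilinAt (b : BilinField M) (p : M) : E3 →L[ℝ] E3 →L[ℝ] ℝ := b p

/-- The expression of a bilinear field in the chart around `x₀`. -/
def bilinRep (b : BilinField M) (x₀ : M) (y : E3) : E3 →L[ℝ] E3 →L[ℝ] ℝ :=
  (bilinAt b ((extChartAt (𝓡 3) x₀).symm y)).bilinearComp (chartSymmDeriv x₀ y)
    (chartSymmDeriv x₀ y)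

variable {α : Form M 1}

theorem IsContactForm.wedgeAlt_formAt_ne_zero (hα : IsContactForm α) (x : M) :
    wedgeAlt (formAt α x) (formAt (extDer α) x) ≠ 0 := hα.wedge_ne_zero x

variable [IsManifold (𝓡 3) ∞ M]

theorem symmL_trivializationAt_eq {x₀ x : M} (hx : x ∈ (chartAt E3 x₀).source) :
    ((trivializationAt E3 (TangentSpace (𝓡 3)) x₀).symmL ℝ x : E3 →L[ℝ] E3) =
      chartSymmDeriv x₀ (extChartAt (𝓡 3) x₀ x) := by
  have : IsManifold (𝓡 3) 1 M := IsManifold.of_le (n := ∞) (by simp)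
  have h := TangentBundle.symmL_trivializationAt (𝕜 := ℝ) (I := 𝓡 3) hx
  rw [ModelWithCorners.range_eq_univ, mfderivWithin_univ] at h
  exact h

/-- The tangent trivialization is inverted by the derivative of the inverse chart, so the induced
trivialization of bilinear forms is pullback by that derivative. Bundle smoothness thereby becomes
smoothness of `bilinRep`. -/
theorem trivializationAt_bilin_apply (b : BilinField M) {x₀ x : M}
    (hx : x ∈ (chartAt E3 x₀).source) :
    (trivializationAt (E3 →L[ℝ] E3 →L[ℝ] ℝ)
      (fun x : M ↦ TangentSpace (𝓡 3) x →L[ℝ] TangentSpace (𝓡 3) x →L[ℝ] ℝ) x₀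
        (Bundle.TotalSpace.mk' (E3 →L[ℝ] E3 →L[ℝ] ℝ) x (b x))).2 =
      bilinRep b x₀ (extChartAt (𝓡 3) x₀ x) := by
  have hs : x ∈ (extChartAt (𝓡 3) x₀).source := by rwa [extChartAt_source]
  rw [bilinRep, ← symmL_trivializationAt_eq hx, (extChartAt (𝓡 3) x₀).left_inv hs]
  ext v w
  rw [hom_trivializationAt_apply]
  simp only [ContinuousLinearMap.inCoordinates, ContinuousLinearMap.comp_apply]
  rw [Bundle.Trivialization.continuousLinearMapAt_apply,
    Bundle.Trivialization.linearMapAt_apply]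
  rw [if_pos]
  · rw [hom_trivializationAt_apply]
    simp only [ContinuousLinearMap.inCoordinates, ContinuousLinearMap.comp_apply]
    rw [Bundle.Trivialization.continuousLinearMapAt_apply]
    simp
    rfl
  · simpa using hx

set_option synthInstance.maxHeartbeats 400000 in
set_option maxHeartbeats 1000000 in
theorem contMDiffOn_bilinField_iff {b : BilinField M} {x₀ : M} :
    ContMDiffOn (𝓡 3) ((𝓡 3).prod 𝓘(ℝ, E3 →L[ℝ] E3 →L[ℝ] ℝ)) ∞
      (fun x ↦ Bundle.TotalSpace.mk' (E3 →L[ℝ] E3 →L[ℝ] ℝ)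
        (E := fun x : M ↦ TangentSpace (𝓡 3) x →L[ℝ] TangentSpace (𝓡 3) x →L[ℝ] ℝ) x (b x))
      (chartAt E3 x₀).source ↔
    ContDiffOn ℝ ∞ (bilinRep b x₀) (extChartAt (𝓡 3) x₀).target := by
  rw [(trivializationAt (E3 →L[ℝ] E3 →L[ℝ] ℝ)
      (fun x : M ↦ TangentSpace (𝓡 3) x →L[ℝ] TangentSpace (𝓡 3) x →L[ℝ] ℝ)
      x₀).contMDiffOn_section_iff (chartAt E3 x₀).open_source (by simp)]
  rw [contMDiffOn_congr fun x hx ↦ trivializationAt_bilin_apply b hx]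
  constructor
  · intro h
    refine contMDiffOn_iff_contDiffOn.1 ((h.comp (contMDiffOn_extChartAt_symm x₀)
      fun y hy ↦ ?_).congr fun y hy ↦ ?_)
    · have := (extChartAt (𝓡 3) x₀).map_target hy
      rwa [extChartAt_source] at this
    · simp only [Function.comp_apply, (extChartAt (𝓡 3) x₀).right_inv hy]
  · intro h
    refine (contMDiffOn_iff_contDiffOn.2 h).comp contMDiffOn_extChartAt fun x hx ↦ ?_
    exact (extChartAt (𝓡 3) x₀).map_source (by rwa [extChartAt_source])

theorem contMDiff_bilinField_iff {b : BilinField M} :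
    ContMDiff (𝓡 3) ((𝓡 3).prod 𝓘(ℝ, E3 →L[ℝ] E3 →L[ℝ] ℝ)) ∞
      (fun x ↦ Bundle.TotalSpace.mk' (E3 →L[ℝ] E3 →L[ℝ] ℝ)
        (E := fun x : M ↦ TangentSpace (𝓡 3) x →L[ℝ] TangentSpace (𝓡 3) x →L[ℝ] ℝ) x (b x)) ↔
    ∀ x₀, ContDiffOn ℝ ∞ (bilinRep b x₀) (extChartAt (𝓡 3) x₀).target := by
  refine ⟨fun h x₀ ↦ contMDiffOn_bilinField_iff.1 h.contMDiffOn, fun h x ↦ ?_⟩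
  exact (contMDiffOn_bilinField_iff.2 (h x)).contMDiffAt
    ((chartAt E3 x).open_source.mem_nhds (mem_chart_source E3 x))

theorem contDiff_clm_bilin {F : Type*} [NormedAddCommGroup F] [NormedSpace ℝ F] {s : Set F}
    {b : F → E3 →L[ℝ] E3 →L[ℝ] ℝ} (h : ∀ v w, ContDiffOn ℝ ∞ (fun y ↦ b y v w) s) :
    ContDiffOn ℝ ∞ b s :=
  contDiffOn_clm_apply.2 fun v ↦ contDiffOn_clm_apply.2 fun w ↦ h v w

theorem contDiffOn_form_apply {F : Type*} [NormedAddCommGroup F] [NormedSpace ℝ F] {s : Set F}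
    {k : ℕ} {η : F → E3 [⋀^Fin k]→L[ℝ] ℝ} (h : ContDiffOn ℝ ∞ η s) (v : Fin k → E3) :
    ContDiffOn ℝ ∞ (fun y ↦ η y v) s :=
  (ContinuousAlternatingMap.apply ℝ E3 ℝ v).contDiff.comp_contDiffOn h

theorem wedgeAlt_comp_ne_zero {a : E3 [⋀^Fin 1]→L[ℝ] ℝ} {η : E3 [⋀^Fin 2]→L[ℝ] ℝ}
    (h : wedgeAlt a η ≠ 0) {L : E3 →L[ℝ] E3} (hL : LinearMap.det (L : E3 →ₗ[ℝ] E3) ≠ 0) :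
    wedgeAlt (a.compContinuousLinearMap L) (η.compContinuousLinearMap L) ≠ 0 := by
  intro h0
  have := top_form_comp (wedgeAlt a η) L
  rw [← wedgeAlt_compContinuousLinearMap, h0] at this
  exact mul_ne_zero hL (top_form_ne_zero h) this.symm

theorem bilinearComp_comp (b : E3 →L[ℝ] E3 →L[ℝ] ℝ) (L K : E3 →L[ℝ] E3) :
    (b.bilinearComp L L).bilinearComp K K = b.bilinearComp (L.comp K) (L.comp K) := rfl

/-- The bilinear field with the expression `stdReebMetric` in the chart around `x₀`. -/
def localReebField (α : Form M 1) (x₀ : M) : BilinField M := fun x ↦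
  ((stdReebMetric (chartRep α x₀ (extChartAt (𝓡 3) x₀ x))
    (chartRep (extDer α) x₀ (extChartAt (𝓡 3) x₀ x))).bilinearComp
      (chartDeriv x₀ x) (chartDeriv x₀ x) : E3 →L[ℝ] E3 →L[ℝ] ℝ)

theorem bilinRep_localReebField (α : Form M 1) {x₀ : M} {y : E3}
    (hy : y ∈ (extChartAt (𝓡 3) x₀).target) :
    bilinRep (localReebField α x₀) x₀ y =
      stdReebMetric (chartRep α x₀ y) (chartRep (extDer α) x₀ y) := by
  have h : bilinAt (localReebField α x₀) ((extChartAt (𝓡 3) x₀).symm y) =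
    (stdReebMetric (chartRep α x₀ y) (chartRep (extDer α) x₀ y)).bilinearComp
      (chartDeriv x₀ ((extChartAt (𝓡 3) x₀).symm y))
      (chartDeriv x₀ ((extChartAt (𝓡 3) x₀).symm y)) := by
    rw [bilinAt, localReebField, (extChartAt (𝓡 3) x₀).right_inv hy]
  rw [bilinRep, h, bilinearComp_comp, chartDeriv_comp_chartSymmDeriv hy]
  rfl

theorem contDiffOn_bilinRep_localReebField (hα : IsContactForm α) (x₀ : M) :
    ContDiffOn ℝ ∞ (bilinRep (localReebField α x₀) x₀) (extChartAt (𝓡 3) x₀).target := by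
  have h1 := hα.smooth x₀
  have h2 := isSmoothForm_extDer hα.smooth x₀
  refine (contDiff_clm_bilin fun v w ↦ ?_).congr fun y hy ↦ bilinRep_localReebField α hy
  simp only [stdReebMetric_apply]
  refine ((contDiffOn_form_apply h1 _).mul (contDiffOn_form_apply h1 _)).add
    (ContDiffOn.sum fun i _ ↦ (contDiffOn_form_apply h2 _).mul (contDiffOn_form_apply h2 _))

theorem chartSymmDeriv_chartDeriv_apply {x₀ x : M} (hx : x ∈ (extChartAt (𝓡 3) x₀).source)
    (v : E3) : chartSymmDeriv x₀ (extChartAt (𝓡 3) x₀ x) (chartDeriv x₀ x v) = v := by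
  have h := chartSymmDeriv_comp_chartDeriv ((extChartAt (𝓡 3) x₀).map_source hx)
  rw [(extChartAt (𝓡 3) x₀).left_inv hx] at h
  exact congrArg (fun L : E3 →L[ℝ] E3 ↦ L v) h

theorem chartDeriv_chartSymmDeriv_apply {x₀ x : M} (hx : x ∈ (extChartAt (𝓡 3) x₀).source)
    (v : E3) : chartDeriv x₀ x (chartSymmDeriv x₀ (extChartAt (𝓡 3) x₀ x) v) = v := by
  have h := chartDeriv_comp_chartSymmDeriv ((extChartAt (𝓡 3) x₀).map_source hx)
  rw [(extChartAt (𝓡 3) x₀).left_inv hx] at h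
  exact congrArg (fun L : E3 →L[ℝ] E3 ↦ L v) h

theorem chartRep_wedge_ne_zero (hα : IsContactForm α) {x₀ : M} {y : E3}
    (hy : y ∈ (extChartAt (𝓡 3) x₀).target) :
    wedgeAlt (chartRep α x₀ y) (chartRep (extDer α) x₀ y) ≠ 0 := by
  rw [chartRep_eq, chartRep_eq]
  exact wedgeAlt_comp_ne_zero (hα.wedgeAlt_formAt_ne_zero _) (det_chartSymmDeriv_ne_zero hy)

theorem localReebField_mem (hα : IsContactForm α) {x₀ x : M}
    (hx : x ∈ (extChartAt (𝓡 3) x₀).source) :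
    bilinAt (localReebField α x₀) x ∈ reebMetrics (formAt α x) (formAt (extDer α) x) := by
  have h := comp_mem_reebMetrics (stdReebMetric_mem
      (chartRep_wedge_ne_zero hα ((extChartAt (𝓡 3) x₀).map_source hx)))
    (chartDeriv_chartSymmDeriv_apply hx) (chartSymmDeriv_chartDeriv_apply hx)
  rw [chartRep_extChartAt_comp α hx, chartRep_extChartAt_comp (extDer α) hx] at h
  exact h

set_option synthInstance.maxHeartbeats 400000 in
set_option maxHeartbeats 1000000 in
theorem exists_reebField [T2Space M] [SecondCountableTopology M] (hα : IsContactForm α) :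
    ∃ b : BilinField M,
      (∀ x₀, ContDiffOn ℝ ∞ (bilinRep b x₀) (extChartAt (𝓡 3) x₀).target) ∧
      ∀ x, bilinAt b x ∈ reebMetrics (formAt α x) (formAt (extDer α) x) := by
  -- With second countability this gives σ-compactness, as partitions of unity require. The `⊤`
  -- below lies in `ℕ∞`: smooth, not analytic.
  have : LocallyCompactSpace M := Manifold.locallyCompact_of_finiteDimensional (𝓡 3)
  obtain ⟨s, hs⟩ := exists_contMDiffSection_forall_mem_convex_of_local (n := ⊤) (𝓡 3)
    (F_fiber := E3 →L[ℝ] E3 →L[ℝ] ℝ)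
    (fun x : M ↦ TangentSpace (𝓡 3) x →L[ℝ] TangentSpace (𝓡 3) x →L[ℝ] ℝ)
    (fun x ↦ reebMetrics (formAt α x) (formAt (extDer α) x))
    (fun x b hb c hc _ _ hs ht hst ↦
      convex_reebMetrics (formAt α x) (formAt (extDer α) x) hb hc hs ht hst)
    (fun x₀ ↦ ⟨(chartAt E3 x₀).source,
      (chartAt E3 x₀).open_source.mem_nhds (mem_chart_source E3 x₀), localReebField α x₀,
      contMDiffOn_bilinField_iff.2 (contDiffOn_bilinRep_localReebField hα x₀),
      fun x hx ↦ localReebField_mem hα (by rwa [extChartAt_source])⟩)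
  exact ⟨fun x ↦ s x, contMDiff_bilinField_iff.1 s.contMDiff, hs⟩

end

/-! ### Riemannian metrics and the Hodge star of the contact form -/

section

/-- By compactness the quadratic form has a positive minimum `m` on the unit sphere, so `‖v‖² ≤ 1/m`
on its unit ball. -/
theorem isVonNBounded_of_pos (b : E3 →L[ℝ] E3 →L[ℝ] ℝ) (hb : ∀ v, v ≠ 0 → 0 < b v v) :
    Bornology.IsVonNBounded ℝ {v : E3 | b v v < 1} := by
  have hc : Continuous fun v : E3 ↦ b v v := by fun_prop
  obtain ⟨u, hu, hmin⟩ := (isCompact_sphere (0 : E3) 1).exists_isMinOn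
    (NormedSpace.sphere_nonempty.2 zero_le_one) hc.continuousOn
  have hu0 : u ≠ 0 := by
    rintro rfl
    simp at hu
  have hm := hb u hu0
  rw [NormedSpace.isVonNBounded_iff, isBounded_iff_forall_norm_le]
  refine ⟨Real.sqrt (b u u)⁻¹, fun v hv ↦ Real.le_sqrt_of_sq_le ?_⟩
  rw [← one_div, le_div_iff₀ hm]
  by_cases h0 : v = 0
  · simp [h0]
  have hn := norm_pos_iff.2 h0
  have h1 : b u u ≤ b (‖v‖⁻¹ • v) (‖v‖⁻¹ • v) :=
    hmin (by simp [norm_smul, hn.ne'])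
  simp only [map_smul, smul_apply, smul_eq_mul] at h1
  have h2 : ‖v‖ ^ 2 * (‖v‖⁻¹ * (‖v‖⁻¹ * b v v)) = b v v := by field_simp
  calc ‖v‖ ^ 2 * b u u ≤ ‖v‖ ^ 2 * (‖v‖⁻¹ * (‖v‖⁻¹ * b v v)) := by gcongr
    _ ≤ 1 := by
      rw [h2]
      exact le_of_lt hv

theorem interiorAlt_smul {k : ℕ} (c : ℝ) (v : E3) (η : E3 [⋀^Fin (k + 1)]→L[ℝ] ℝ) :
    interiorAlt (c • v) η = c • interiorAlt v η :=
  map_smul η.curryLeft c v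

theorem contDiffOn_const_smul_bilin {b : E3 → E3 →L[ℝ] E3 →L[ℝ] ℝ} {s : Set E3}
    (h : ContDiffOn ℝ ∞ b s) (c : ℝ) : ContDiffOn ℝ ∞ (fun y ↦ c • b y) s :=
  contDiff_clm_bilin fun _ _ ↦ contDiffOn_const.mul
    ((h.clm_apply contDiffOn_const).clm_apply contDiffOn_const)

/-- Definiteness gives injectivity, and the dimensions agree. It ensures that `inverse` in `sharp`
is the true inverse and not its default value. -/
theorem isInvertible_of_pos (b : E3 →L[ℝ] E3 →L[ℝ] ℝ) (hb : ∀ v, v ≠ 0 → 0 < b v v) :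
    b.IsInvertible := by
  have hinj : Function.Injective (b : E3 →ₗ[ℝ] E3 →L[ℝ] ℝ) := by
    rw [injective_iff_map_eq_zero]
    intro v hv
    by_contra h0
    have := hb v h0
    rw [show b v = 0 from hv] at this
    simp at this
  have hdim : Module.finrank ℝ E3 = Module.finrank ℝ (E3 →L[ℝ] ℝ) := by
    rw [← (LinearMap.toContinuousLinearMap : (E3 →ₗ[ℝ] ℝ) ≃ₗ[ℝ] E3 →L[ℝ] ℝ).finrank_eq]
    exact Subspace.dual_finrank_eq.symm
  exact ⟨(LinearEquiv.ofInjectiveOfFinrankEq _ hinj hdim).toContinuousLinearEquiv, by ext; rfl⟩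

variable {M : Type*} [TopologicalSpace M] [ChartedSpace E3 M] [IsManifold (𝓡 3) ∞ M]

/-- The Riemannian metric given by a smooth positive definite bilinear field. -/
def metricOf (b : BilinField M) (hsymm : ∀ x v w, bilinAt b x v w = bilinAt b x w v)
    (hpos : ∀ x v, v ≠ 0 → 0 < bilinAt b x v v)
    (hsm : ∀ x₀, ContDiffOn ℝ ∞ (bilinRep b x₀) (extChartAt (𝓡 3) x₀).target) : RMetric M where
  inner := b
  symm := hsymm
  pos := hpos
  isVonNBounded x := isVonNBounded_of_pos (bilinAt b x) (hpos x)
  contMDiff := contMDiff_bilinField_iff.2 hsm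

theorem gram_eq (g : RMetric M) (x : M) : gram g x = gramMat (bilinAt g.inner x) := rfl

theorem sharp_eq_of_inner {g : RMetric M} {a : Form M 1} {x : M} {r : E3}
    (h : bilinAt g.inner x r = toCovector (formAt a x)) : sharp g a x = r :=
  (isInvertible_of_pos (bilinAt g.inner x) (g.pos x)).inverse_apply_eq.2 h.symm

theorem hodge_smul (g : RMetric M) (θ : Form M 3) (a : Form M 1) (c : ℝ) (x : M) :
    hodge g θ (fun x ↦ c • a x) x = c • hodge g θ a x := by
  have h : sharp g (fun x ↦ c • a x) x = c • sharp g a x := by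
    have : toCovector (c • a x) = c • toCovector (a x) := by
      ext v
      simp [toCovector_apply]
    rw [sharp, this, map_smul]
    rfl
  rw [hodge, h]
  exact interiorAlt_smul c (sharp g a x) (volForm g θ x)

variable {α : Form M 1}

section Pointwise

variable {g : RMetric M} {x : M} {c : ℝ} {b : E3 →L[ℝ] E3 →L[ℝ] ℝ}

theorem sharp_of_reebMetric (hc : 0 < c) (hg : bilinAt g.inner x = c ^ 2 • b)
    (hb : b ∈ reebMetrics (formAt α x) (formAt (extDer α) x)) {r : E3}
    (hr1 : formAt α x ![r] = 1) (hr2 : ∀ v, formAt (extDer α) x ![r, v] = 0) :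
    sharp g α x = (c ^ 2)⁻¹ • r := by
  refine sharp_eq_of_inner ?_
  ext v
  rw [hg, map_smul, toCovector_apply]
  simp [hb.2.2 r hr2, hr1, hc.ne']

/-- Replacing `b` by `c² b` multiplies the volume form by `c³` and `α♯` by `c⁻²`, hence `⋆α` by `c`.
The case `c = 1` gives adaptedness, the case `c = 2/|ω|` the medium. -/
theorem hodge_of_reebMetric (hα : IsContactForm α) (hc : 0 < c)
    (hg : bilinAt g.inner x = c ^ 2 • b)
    (hb : b ∈ reebMetrics (formAt α x) (formAt (extDer α) x))
    (hdet : Real.sqrt (gramMat b).det =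
      |wedgeAlt (formAt α x) (formAt (extDer α) x) stdVec| / 2) :
    hodge g (wedge α (extDer α)) α x = (c / 2) • extDer α x := by
  have h := hα.wedgeAlt_formAt_ne_zero x
  obtain ⟨r, hr1, hr2⟩ := exists_reeb h
  have hθ := abs_ne_zero.2 (top_form_ne_zero h)
  have hvol : Real.sqrt (gram g x).det / |wedge α (extDer α) x (coordVec x)| = c ^ 3 / 2 := by
    have h1 : gram g x = c ^ 2 • gramMat b := by
      rw [gram_eq, hg]
      ext i j
      simp [gramMat]
    have h2 : |wedge α (extDer α) x (coordVec x)| =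
      |wedgeAlt (formAt α x) (formAt (extDer α) x) stdVec| := rfl
    rw [h1, h2, Matrix.det_smul, Fintype.card_fin, Real.sqrt_mul (by positivity), hdet,
      show (c ^ 2) ^ 3 = (c ^ 3) ^ 2 by ring, Real.sqrt_sq (by positivity)]
    field_simp
  rw [hodge, sharp_of_reebMetric hc hg hb hr1 hr2, volForm, hvol]
  have h3 : interiorAlt ((c ^ 2)⁻¹ • r)
      ((c ^ 3 / 2) • wedgeAlt (formAt α x) (formAt (extDer α) x)) =
      (c / 2) • formAt (extDer α) x := by
    conv_rhs => rw [← interiorAlt_wedgeAlt _ _ hr1 hr2]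
    have h4 : interiorAlt r ((c ^ 3 / 2) • wedgeAlt (formAt α x) (formAt (extDer α) x)) =
        (c ^ 3 / 2) • interiorAlt r (wedgeAlt (formAt α x) (formAt (extDer α) x)) := rfl
    rw [interiorAlt_smul, h4, smul_smul]
    congr 1
    field_simp
  exact h3

end Pointwise

/-! ### Construction of the adapted metric -/

/-- The scaling of a bilinear field on the kernel of a contact form that makes the volume form
`α ∧ dα / 2`. -/
def adaptedField (α : Form M 1) (b : BilinField M) : BilinField M := fun x ↦
  scaleKer (formAt α x)
    (volRatio (wedgeAlt (formAt α x) (formAt (extDer α) x)) (bilinAt b x)) (bilinAt b x)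

theorem bilinRep_adaptedField (α : Form M 1) (b : BilinField M) {x₀ : M} {y : E3}
    (hy : y ∈ (extChartAt (𝓡 3) x₀).target) :
    bilinRep (adaptedField α b) x₀ y = scaleKer (chartRep α x₀ y)
      (volRatio (wedgeAlt (chartRep α x₀ y) (chartRep (extDer α) x₀ y)) (bilinRep b x₀ y))
      (bilinRep b x₀ y) := by
  rw [chartRep_eq, chartRep_eq, wedgeAlt_compContinuousLinearMap, bilinRep, bilinRep,
    volRatio_comp _ _ (det_chartSymmDeriv_ne_zero hy)]
  ext v w
  rw [scaleKer_apply, ContinuousLinearMap.bilinearComp_apply, comp_single, comp_single]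
  exact scaleKer_apply _ _ _ _ _

theorem bilinRep_mem_reebMetrics {b : BilinField M}
    (hb : ∀ x, bilinAt b x ∈ reebMetrics (formAt α x) (formAt (extDer α) x)) {x₀ : M} {y : E3}
    (hy : y ∈ (extChartAt (𝓡 3) x₀).target) :
    bilinRep b x₀ y ∈ reebMetrics (chartRep α x₀ y) (chartRep (extDer α) x₀ y) :=
  comp_mem_reebMetrics (hb _)
    (fun v ↦ congrArg (fun L : E3 →L[ℝ] E3 ↦ L v) (chartSymmDeriv_comp_chartDeriv hy))
    (fun v ↦ congrArg (fun L : E3 →L[ℝ] E3 ↦ L v) (chartDeriv_comp_chartSymmDeriv hy))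

/-- The scaling factor involves an absolute value and a square root, smooth here because the contact
condition and positive definiteness keep their arguments away from zero. -/
theorem contDiffOn_bilinRep_adaptedField (hα : IsContactForm α) {b : BilinField M}
    (hb : ∀ x, bilinAt b x ∈ reebMetrics (formAt α x) (formAt (extDer α) x))
    (hsm : ∀ x₀, ContDiffOn ℝ ∞ (bilinRep b x₀) (extChartAt (𝓡 3) x₀).target) (x₀ : M) :
    ContDiffOn ℝ ∞ (bilinRep (adaptedField α b) x₀) (extChartAt (𝓡 3) x₀).target := by
  have h1 := hα.smooth x₀
  have h2 := isSmoothForm_extDer hα.smooth x₀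
  have hB : ∀ v w, ContDiffOn ℝ ∞ (fun y ↦ bilinRep b x₀ y v w) (extChartAt (𝓡 3) x₀).target :=
    fun v w ↦ ((hsm x₀).clm_apply contDiffOn_const).clm_apply contDiffOn_const
  have hθ : ContDiffOn ℝ ∞ (fun y ↦ wedgeAlt (chartRep α x₀ y) (chartRep (extDer α) x₀ y) stdVec)
      (extChartAt (𝓡 3) x₀).target := by
    simp only [apply_triple_stdVec]
    exact ((((contDiffOn_form_apply h1 _).mul (contDiffOn_form_apply h2 _)).sub
      ((contDiffOn_form_apply h1 _).mul (contDiffOn_form_apply h2 _))).add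
      ((contDiffOn_form_apply h1 _).mul (contDiffOn_form_apply h2 _)))
  have hdet : ContDiffOn ℝ ∞ (fun y ↦ (gramMat (bilinRep b x₀ y)).det)
      (extChartAt (𝓡 3) x₀).target := by
    simp only [Matrix.det_fin_three, gramMat, Matrix.of_apply]
    have := hB (stdVec 0) (stdVec 0)
    have := hB (stdVec 0) (stdVec 1)
    have := hB (stdVec 0) (stdVec 2)
    have := hB (stdVec 1) (stdVec 0)
    have := hB (stdVec 1) (stdVec 1)
    have := hB (stdVec 1) (stdVec 2)
    have := hB (stdVec 2) (stdVec 0)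
    have := hB (stdVec 2) (stdVec 1)
    have := hB (stdVec 2) (stdVec 2)
    fun_prop
  have hpos : ∀ y ∈ (extChartAt (𝓡 3) x₀).target, 0 < (gramMat (bilinRep b x₀ y)).det :=
    fun y hy ↦ det_gramMat_pos (bilinRep_mem_reebMetrics hb hy)
  have hvol : ContDiffOn ℝ ∞ (fun y ↦ volRatio
      (wedgeAlt (chartRep α x₀ y) (chartRep (extDer α) x₀ y)) (bilinRep b x₀ y))
      (extChartAt (𝓡 3) x₀).target := by
    refine ContDiffOn.div (fun y hy ↦ ?_)
      (contDiffOn_const.mul (hdet.sqrt fun y hy ↦ (hpos y hy).ne')) fun y hy ↦ ?_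
    · exact (contDiffAt_abs (top_form_ne_zero (chartRep_wedge_ne_zero hα hy))).comp_contDiffWithinAt
        y (hθ y hy)
    · exact mul_ne_zero two_ne_zero (Real.sqrt_pos.2 (hpos y hy)).ne'
  refine (contDiff_clm_bilin fun v w ↦ ?_).congr fun y hy ↦ bilinRep_adaptedField α b hy
  simp only [scaleKer_apply]
  have haa := (contDiffOn_form_apply h1 ![v]).mul (contDiffOn_form_apply h1 ![w])
  exact haa.add (hvol.mul ((hB v w).sub haa))

/-- A positive constant multiple of a Riemannian metric is a Riemannian metric. -/
theorem exists_metric_eq_smul (g₀ : RMetric M) {c : ℝ} (hc : 0 < c) :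
    ∃ g : RMetric M, ∀ x, g.inner x = c • g₀.inner x := by
  refine ⟨metricOf (fun x ↦ c • g₀.inner x) (fun x v w ↦ ?_) (fun x v hv ↦ ?_) fun x₀ ↦ ?_,
    fun x ↦ rfl⟩
  · exact congrArg (c * ·) (g₀.symm x v w)
  · exact mul_pos hc (g₀.pos x v hv)
  · exact contDiffOn_const_smul_bilin (contMDiff_bilinField_iff.1 g₀.contMDiff x₀) c

/-- The pointwise conditions are recorded in place of `IsAdapted`, since they also determine the
Hodge star of the rescaled metric. -/
theorem exists_adapted_metric [T2Space M] [SecondCountableTopology M] (hα : IsContactForm α) :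
    ∃ g₀ : RMetric M, ∀ x,
      bilinAt g₀.inner x ∈ reebMetrics (formAt α x) (formAt (extDer α) x) ∧
      Real.sqrt (gramMat (bilinAt g₀.inner x)).det =
        |wedgeAlt (formAt α x) (formAt (extDer α) x) stdVec| / 2 := by
  obtain ⟨b, hsm, hb⟩ := exists_reebField hα
  have hmem : ∀ x, bilinAt (adaptedField α b) x ∈
      reebMetrics (formAt α x) (formAt (extDer α) x) := fun x ↦
    scaleKer_mem (hb x) (hα.wedgeAlt_formAt_ne_zero x)
      (volRatio_pos (hb x) (hα.wedgeAlt_formAt_ne_zero x))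
  exact ⟨metricOf (adaptedField α b) (fun x ↦ (hmem x).1) (fun x ↦ (hmem x).2.1)
    (contDiffOn_bilinRep_adaptedField hα hb hsm), fun x ↦
    ⟨hmem x, sqrt_det_scaleKer_volRatio (hb x) (hα.wedgeAlt_formAt_ne_zero x)⟩⟩

theorem isAdapted_of_reebMetric (hα : IsContactForm α) {g₀ : RMetric M}
    (hg : ∀ x, bilinAt g₀.inner x ∈ reebMetrics (formAt α x) (formAt (extDer α) x) ∧
      Real.sqrt (gramMat (bilinAt g₀.inner x)).det =
        |wedgeAlt (formAt α x) (formAt (extDer α) x) stdVec| / 2) : IsAdapted g₀ α where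
  extDer_eq x := by
    rw [hodge_of_reebMetric hα one_pos (by rw [one_pow, one_smul]) (hg x).1 (hg x).2, smul_smul]
    norm_num
  norm_sharp x := by
    obtain ⟨r, hr1, hr2⟩ := exists_reeb (hα.wedgeAlt_formAt_ne_zero x)
    rw [sharp_of_reebMetric one_pos (by rw [one_pow, one_smul]) (hg x).1 hr1 hr2, one_pow, inv_one,
      one_smul]
    have := (hg x).1.2.2 r hr2 r
    rw [hr1, one_mul] at this
    exact this

end

/-! ### Time-harmonic fields and the Maxwell equations -/

section

theorem re_mul_exp (a om t : ℝ) :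
    ((a : ℂ) * Complex.exp (Complex.I * om * t)).re = Real.cos (om * t) * a := by
  rw [show Complex.I * om * t = ((om * t : ℝ) : ℂ) * Complex.I by push_cast; ring,
    Complex.re_ofReal_mul, Complex.exp_ofReal_mul_I_re, mul_comm]

theorem im_mul_exp (a om t : ℝ) :
    ((a : ℂ) * Complex.exp (Complex.I * om * t)).im = Real.sin (om * t) * a := by
  rw [show Complex.I * om * t = ((om * t : ℝ) : ℂ) * Complex.I by push_cast; ring,
    Complex.im_ofReal_mul, Complex.exp_ofReal_mul_I_im, mul_comm]

theorem hasDerivAt_cos_mul (om t : ℝ) :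
    HasDerivAt (fun s ↦ Real.cos (om * s)) (-(om * Real.sin (om * t))) t := by
  have h := ((hasDerivAt_id t).const_mul om).cos
  simp only [id, mul_one] at h
  exact h.congr_deriv (by ring)

theorem hasDerivAt_sin_mul (om t : ℝ) :
    HasDerivAt (fun s ↦ Real.sin (om * s)) (om * Real.cos (om * t)) t := by
  have h := ((hasDerivAt_id t).const_mul om).sin
  simp only [id, mul_one] at h
  exact h.congr_deriv (by ring)

variable {M : Type*} [TopologicalSpace M] [ChartedSpace E3 M] [IsManifold (𝓡 3) ∞ M]

/-- The Maxwell equations for fields proportional to a form and to its exterior derivative. -/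
theorem isSourceFreeMaxwell_of_smul {α : Form M 1} (hα : IsSmoothForm α)
    {e h d b : ℝ → ℝ} (he : ContDiff ℝ ∞ e) (hh : ContDiff ℝ ∞ h) (hd : ContDiff ℝ ∞ d)
    (hb : ContDiff ℝ ∞ b) (hbe : ∀ t, HasDerivAt b (-e t) t) (hdh : ∀ t, HasDerivAt d (h t) t) :
    IsSourceFreeMaxwell (fun t x ↦ e t • α x) (fun t x ↦ h t • α x)
      (fun t x ↦ d t • extDer α x) (fun t x ↦ b t • extDer α x) where
  smooth_E := isSmoothFamily_smul he hα
  smooth_H := isSmoothFamily_smul hh hα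
  smooth_D := isSmoothFamily_smul hd (isSmoothForm_extDer hα)
  smooth_B := isSmoothFamily_smul hb (isSmoothForm_extDer hα)
  faraday t x v := by
    rw [extDer_smul]
    have := (hbe t).mul_const (extDer α x v)
    rw [neg_mul] at this
    exact this
  ampere t x v := by
    rw [extDer_smul]
    exact (hdh t).mul_const (extDer α x v)
  gauss_D t x := by rw [extDer_smul, extDer_extDer hα, smul_zero]
  gauss_B t x := by rw [extDer_smul, extDer_extDer hα, smul_zero]

end

end ContactMaxwell

end

theorem theorem1 {M : Type*} [TopologicalSpace M] [T2Space M] [SecondCountableTopology M]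
    [ChartedSpace ContactMaxwell.E3 M] [IsManifold (𝓡 3) ∞ M]
    (α : ContactMaxwell.Form M 1) (hα : ContactMaxwell.IsContactForm α)
    (om : ℝ) (hom : om ≠ 0) :
    ∃ g₀ : ContactMaxwell.RMetric M, ContactMaxwell.IsAdapted g₀ α ∧
    ∃ g : ContactMaxwell.RMetric M,
      (∀ (x : M) (v w : TangentSpace (𝓡 3) x),
        g.inner x v w = 4 / om ^ 2 * g₀.inner x v w) ∧
    ∃ β : ContactMaxwell.Form M 1, ContactMaxwell.IsSmoothForm β ∧
    ∃ (E H : ℝ → ContactMaxwell.Form M 1) (D B : ℝ → ContactMaxwell.Form M 2),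
      (∀ t x v, E t x v = ((α x v : ℂ) * Complex.exp (Complex.I * om * t)).re) ∧
      (∀ t x v, H t x v = ((β x v : ℂ) * Complex.exp (Complex.I * om * t)).im) ∧
      ContactMaxwell.IsSourceFreeMaxwell E H D B ∧
      ContactMaxwell.IsConstitutive g g
        (ContactMaxwell.wedge α (ContactMaxwell.extDer α)) E H D B := by
  obtain ⟨g₀, hg₀⟩ := ContactMaxwell.exists_adapted_metric hα
  have habs : 0 < |om| := abs_pos.2 hom
  -- The conformal factor is `4/ω² = c²`; its positive root `c` needs `|ω|`, as `ω` may be negative.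
  have hc : 0 < 2 / |om| := by positivity
  have hc2 : (2 / |om|) ^ 2 = 4 / om ^ 2 := by rw [div_pow, sq_abs]; norm_num
  obtain ⟨g, hg⟩ := ContactMaxwell.exists_metric_eq_smul g₀ (pow_pos hc 2)
  have hstar : ∀ x, ContactMaxwell.hodge g (ContactMaxwell.wedge α (ContactMaxwell.extDer α)) α x
      = |om|⁻¹ • ContactMaxwell.extDer α x := fun x ↦ by
    rw [ContactMaxwell.hodge_of_reebMetric hα hc (hg x) (hg₀ x).1 (hg₀ x).2]
    congr 1
    field_simp
  have hsq : om * om = |om| * |om| := (abs_mul_abs_self om).symm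
  -- Since `D = cos(ωt) dα/|ω|`, Ampère's law suggests `H = -(ω/|ω|) sin(ωt) α`, which fixes `β`.
  -- Then `⋆H` has coefficient `-(ω/|ω|)/|ω| = -1/ω`, exactly what Faraday's law needs.
  refine ⟨g₀, ContactMaxwell.isAdapted_of_reebMetric hα hg₀, g, fun x v w ↦ ?_,
    fun x ↦ (-(om / |om|)) • α x, ContactMaxwell.isSmoothForm_smul _ hα.smooth,
    fun t x ↦ Real.cos (om * t) • α x,
    fun t x ↦ (Real.sin (om * t) * -(om / |om|)) • α x,
    fun t x ↦ (Real.cos (om * t) * |om|⁻¹) • ContactMaxwell.extDer α x,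
    fun t x ↦ (Real.sin (om * t) * -om⁻¹) • ContactMaxwell.extDer α x,
    fun t x v ↦ ?_, fun t x v ↦ ?_,
    ContactMaxwell.isSourceFreeMaxwell_of_smul hα.smooth (by fun_prop) (by fun_prop)
      (by fun_prop) (by fun_prop) (fun t ↦ ?_) fun t ↦ ?_, fun t x ↦ ?_, fun t x ↦ ?_⟩
  · rw [hg x, hc2]
    rfl
  · exact (ContactMaxwell.re_mul_exp (α x v) om t).symm
  · refine Eq.trans ?_ (ContactMaxwell.im_mul_exp (-(om / |om|) * α x v) om t).symm
    exact mul_assoc _ _ (α x v)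
  · refine ((ContactMaxwell.hasDerivAt_sin_mul om t).mul_const (-om⁻¹)).congr_deriv ?_
    field_simp
  · refine ((ContactMaxwell.hasDerivAt_cos_mul om t).mul_const |om|⁻¹).congr_deriv ?_
    field_simp
  · rw [ContactMaxwell.hodge_smul, hstar, smul_smul]
  · rw [ContactMaxwell.hodge_smul, hstar, smul_smul]
    congr 1
    field_simp
    linear_combination Real.sin (om * t) * hsq
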